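/- **Theorem 1 (Göllnitz–Gordon–Andrews identities).** A partition of an integer $n\ge 0$ is a finite non-increasing sequence $(\lambda_1,\lambda_2,\ldots,\lambda_s)$ of positive integers with sum $n$ (the empty sequence being the only partition of $0$). Let $r$ and $i$ be integers with $1\le i\le r$. Let $C_{r,i}(n)$ be the number of partitions of $n$ into parts that are not congruent to $2 \pmod 4$ and not congruent to $0$ or $\pm(2i-1) \pmod{4r}$. Let $D_{r,i}(n)$ be the number of partitions $(\lambda_1,\ldots,\lambda_s)$ of $n$ such that 1. no odd part is repeated; 2. $\lambda_m-\lambda_{m+r-1}\ge 2$ whenever $1\le m\le m+r-1\le s$ and $\lambda_m$ is odd; 3. $\lambda_m-\lambda_{m+r-1}\ge 3$ whenever $1\le m\le m+r-1\le s$ and $\lambda_m$ is even; 4. at most $i-1$ parts, counted with multiplicity, are equal to $1$ or $2$. Then $C_{r,i}(n)=D_{r,i}(n)$ for all $n\ge 0$. In particular, the case $r=2$ gives the classical Göllnitz–Gordon identities. For all $n\ge 0$, the number of partitions of $n$ into parts congruent to $1$, $4$ or $7 \pmod 8$ equals the number of partitions $(\lambda_1,\ldots,\lambda_s)$ of $n$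 such that, for $1\le m<s$, $\lambda_m-\lambda_{m+1}\ge 2$, and $\lambda_m-\lambda_{m+1}\ge 3$ if $\lambda_m$ is even. Likewise, the number of partitions of $n$ into parts congruent to $3$, $4$ or $5 \pmod 8$ equals the number of partitions of $n$ that satisfy the same difference conditions and have all parts at least $3$. -/

import Mathlib

/-- The parts of a partition `p` of `n`, listed in non-increasing order `[λ₁, λ₂, …, λₛ]`;
the list is indexed from `0`. -/
def partList {n : ℕ} (p : n.Partition) : List ℕ :=
  p.parts.sort (· ≥ ·)

/-- No part of `p` is `≡ 2 (mod 4)`, and none is `≡ 0` or `≡ ±(2i - 1) (mod 4r)`. -/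
def IsCPartition (r i : ℕ) {n : ℕ} (p : n.Partition) : Prop :=
  ∀ a ∈ p.parts,
    ¬ (a : ℤ) ≡ 2 [ZMOD 4] ∧
    ¬ (a : ℤ) ≡ 0 [ZMOD 4 * (r : ℤ)] ∧
    ¬ (a : ℤ) ≡ 2 * (i : ℤ) - 1 [ZMOD 4 * (r : ℤ)] ∧
    ¬ (a : ℤ) ≡ -(2 * (i : ℤ) - 1) [ZMOD 4 * (r : ℤ)]

/-- `C_{r,i}(n)`. -/
noncomputable def numC (r i n : ℕ) : ℕ :=
  Nat.card {p : n.Partition // IsCPartition r i p}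

/-- Whenever `λ_m` and `λ_{m+d}` are both parts of `p`, their difference is at least `2` if `λ_m`
is odd, and at least `3` if `λ_m` is even. -/
def HasGaps (d : ℕ) {n : ℕ} (p : n.Partition) : Prop :=
  ∀ (m : ℕ) (h : m + d < (partList p).length),
    (Odd ((partList p)[m]) → (partList p)[m + d] + 2 ≤ (partList p)[m]) ∧
    (Even ((partList p)[m]) → (partList p)[m + d] + 3 ≤ (partList p)[m])

/-- No odd part of `p` is repeated, `λ_m - λ_{m+r-1}` is at least `2` if `λ_m` is odd and at least
`3` if `λ_m` is even, and at most `i - 1` parts (counted with multiplicity) are `1` or `2`. -/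
structure IsDPartition (r i : ℕ) {n : ℕ} (p : n.Partition) : Prop where
  odd_not_repeated : ∀ a ∈ p.parts, Odd a → p.parts.count a = 1
  gaps : HasGaps (r - 1) p
  ones_twos : p.parts.count 1 + p.parts.count 2 ≤ i - 1

/-- `D_{r,i}(n)`. -/
noncomputable def numD (r i n : ℕ) : ℕ :=
  Nat.card {p : n.Partition // IsDPartition r i p}

/-! The difference conditions say exactly that every window `2l, 2l+1, 2l+2` contains at most `r -
1` parts (`hasGaps_iff`). The D-partitions are thus the case `k = 0` of a family of multisets with
parts above `2k`. Sorting by the multiplicities of `2k+1` and `2k+2` gives recurrences for the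
generating functions (`gapMultisets_zero`, `genFun_gapMultisets_succ`). Since in any fixed degree
the generating function agrees with `1` once `k` is large, the recurrences determine the whole
family.

Andrews' series satisfy the same recurrences (`series_zero`, `series_succ`), because the termwise
defect telescopes. Hence the series is the D generating function times `(q²;q²)_∞ / (-q;q²)_∞`. At
`k = 0` it is a theta series, and the Jacobi triple product turns it into the product of `1 - q^a`
over `a ≡ 0, ±(2i-1) (mod 4r)`. As `(q²;q²)_∞ / (-q;q²)_∞` is the product over all `a ≢ 2 (mod 4)`,
the quotient is the reciprocal of the product over the parts allowed in C-partitions, which is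
Euler's product for the C generating function.

Convergence never enters: coefficients are compared modulo a power of `X`, where `q` is nilpotent
and all products and series are finite. The finite triple product is proved in a domain and then
mapped to the quotient. In the lemmas `i` stands for `i - 1` of the theorem and `j` for `r - i`, so
that no subtraction occurs. -/

namespace GollnitzGordon

open PowerSeries

/-! ### Generating functions of sets of multisets -/

/-- The elements of `S` with sum `n`. -/
def level (S : Set (Multiset ℕ)) (n : ℕ) : Set (Multiset ℕ) := {s | s ∈ S ∧ s.sum = n}

/-- The generating function, by sum, of a set of multisets. -/
noncomputable def genFun (S : Set (Multiset ℕ)) : ℤ⟦X⟧ :=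
  PowerSeries.mk fun n => ((level S n).ncard : ℤ)

lemma coeff_genFun (S : Set (Multiset ℕ)) (n : ℕ) :
    coeff n (genFun S) = ((level S n).ncard : ℤ) := by
  simp [genFun]

lemma level_eq_image {S : Set (Multiset ℕ)} (hS : ∀ s ∈ S, 0 ∉ s) (n : ℕ) :
    level S n = Nat.Partition.parts '' {p : n.Partition | p.parts ∈ S} := by
  ext s
  simp only [level, Set.mem_ofPred_eq, Set.mem_image]
  constructor
  · rintro ⟨h, rfl⟩
    exact ⟨⟨s, fun {a} ha => Nat.pos_of_ne_zero fun h0 => hS s h (h0 ▸ ha), rfl⟩, h, rfl⟩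
  · rintro ⟨p, hp, rfl⟩
    exact ⟨hp, p.parts_sum⟩

lemma finite_level {S : Set (Multiset ℕ)} (hS : ∀ s ∈ S, 0 ∉ s) (n : ℕ) :
    (level S n).Finite := by
  rw [level_eq_image hS]
  exact (Set.toFinite _).image _

lemma card_partition {S : Set (Multiset ℕ)} (hS : ∀ s ∈ S, 0 ∉ s) (n : ℕ) :
    (Nat.card {p : n.Partition // p.parts ∈ S} : ℤ) = coeff n (genFun S) := by
  rw [coeff_genFun, level_eq_image hS,
    Set.ncard_image_of_injective _ fun p q h => Nat.Partition.ext h]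
  rfl

lemma genFun_union {S T : Set (Multiset ℕ)} (hS : ∀ s ∈ S, 0 ∉ s) (hT : ∀ s ∈ T, 0 ∉ s)
    (h : Disjoint S T) : genFun (S ∪ T) = genFun S + genFun T := by
  ext n
  rw [map_add, coeff_genFun, coeff_genFun, coeff_genFun, ← Nat.cast_add, ← Set.ncard_union_eq
    (h.mono (fun _ hx => hx.1) fun _ hx => hx.1) (finite_level hS n) (finite_level hT n)]
  congr 2
  ext s
  simp only [level, Set.mem_union, Set.mem_ofPred_eq, or_and_right]

lemma genFun_translate (S : Set (Multiset ℕ)) (t : Multiset ℕ) :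
    genFun ((· + t) '' S) = X ^ t.sum * genFun S := by
  ext n
  rw [coeff_X_pow_mul', coeff_genFun]
  split_ifs with h
  · rw [coeff_genFun, ← Set.ncard_image_of_injective (level S (n - t.sum)) (add_left_injective t)]
    congr 2
    ext s
    simp only [level, Set.mem_image, Set.mem_ofPred_eq]
    constructor
    · rintro ⟨⟨u, hu, rfl⟩, hs⟩
      rw [Multiset.sum_add] at hs
      exact ⟨u, ⟨hu, by omega⟩, rfl⟩
    · rintro ⟨u, ⟨hu, hs⟩, rfl⟩
      rw [Multiset.sum_add]
      exact ⟨⟨u, hu, rfl⟩, by omega⟩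
  · rw [show level ((· + t) '' S) n = ∅ from ?_]
    · simp
    · ext s
      simp only [level, Set.mem_image, Set.mem_ofPred_eq, Set.mem_empty_iff_false, iff_false]
      rintro ⟨⟨u, hu, rfl⟩, hs⟩
      rw [Multiset.sum_add] at hs
      omega

lemma coeff_genFun_congr {S T : Set (Multiset ℕ)} {n : ℕ}
    (h : ∀ s : Multiset ℕ, s.sum = n → (s ∈ S ↔ s ∈ T)) :
    coeff n (genFun S) = coeff n (genFun T) := by
  rw [coeff_genFun, coeff_genFun]
  congr 2
  ext s
  exact and_congr_left (h s)

lemma genFun_singleton_zero : genFun {0} = 1 := by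
  ext n
  rw [coeff_genFun, coeff_one]
  split_ifs with h
  · rw [show level {0} n = {0} from ?_]
    · simp
    · ext s
      simp only [level, Set.mem_singleton_iff, Set.mem_ofPred_eq]
      constructor
      · exact fun h => h.1
      · rintro rfl
        simp [h]
  · rw [show level {0} n = ∅ from ?_]
    · simp
    · ext s
      simp only [level, Set.mem_singleton_iff, Set.mem_ofPred_eq, Set.mem_empty_iff_false,
        iff_false]
      rintro ⟨rfl, hs⟩
      exact h (by simpa using hs.symm)

/-! ### Euler's product for parts in a prescribed set -/

/-- Multisets all of whose elements satisfy `P`. -/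
def partsIn (P : ℕ → Prop) : Set (Multiset ℕ) := {s | ∀ a ∈ s, P a}

/-- A multiset either avoids `a` or arises from a unique one by adding a copy of `a`. -/
lemma genFun_partsIn_insert {P : ℕ → Prop} (hP : ¬ P 0) {a : ℕ} (ha : a ≠ 0) (hPa : ¬ P a) :
    (1 - X ^ a) * genFun (partsIn fun x => x = a ∨ P x) = genFun (partsIn P) := by
  have h0 : ∀ s ∈ partsIn P, 0 ∉ s := fun s hs h => hP (hs 0 h)
  have h1 : ∀ s ∈ (· + {a}) '' partsIn (fun x => x = a ∨ P x), 0 ∉ s := by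
    rintro _ ⟨s, hs, rfl⟩ h
    rcases Multiset.mem_add.1 h with h | h
    · exact (hs 0 h).elim (fun h => ha h.symm) hP
    · exact ha (Multiset.mem_singleton.1 h).symm
  have key : partsIn (fun x => x = a ∨ P x)
      = partsIn P ∪ (· + {a}) '' partsIn (fun x => x = a ∨ P x) := by
    ext s
    constructor
    · intro hs
      by_cases h : a ∈ s
      · refine Or.inr ⟨s.erase a, fun b hb => hs b (Multiset.mem_of_mem_erase hb), ?_⟩
        change s.erase a + {a} = s
        rw [add_comm, Multiset.singleton_add, Multiset.cons_erase h]
      · exact Or.inl fun b hb => (hs b hb).resolve_left fun hba => h (hba ▸ hb)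
    · rintro (hs | ⟨t, ht, rfl⟩)
      · exact fun b hb => Or.inr (hs b hb)
      · intro b hb
        rcases Multiset.mem_add.1 hb with h | h
        · exact ht b h
        · exact Or.inl (Multiset.mem_singleton.1 h)
  have hd : Disjoint (partsIn P) ((· + {a}) '' partsIn (fun x => x = a ∨ P x)) := by
    rw [Set.disjoint_left]
    rintro _ hs ⟨t, -, rfl⟩
    exact hPa (hs a (Multiset.mem_add.2 (Or.inr (Multiset.mem_singleton_self a))))
  have h := genFun_union h0 h1 hd
  rw [← key, genFun_translate, Multiset.sum_singleton] at h
  rw [sub_mul, one_mul, sub_eq_iff_eq_add]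
  exact h

lemma prod_mul_genFun_partsIn (T : Finset ℕ) (hT : 0 ∉ T) :
    (∏ a ∈ T, (1 - X ^ a)) * genFun (partsIn (· ∈ T)) = 1 := by
  induction T using Finset.induction_on with
  | empty =>
    rw [Finset.prod_empty, one_mul, ← genFun_singleton_zero]
    congr 1
    ext s
    simp [partsIn, Multiset.eq_zero_iff_forall_notMem]
  | insert a T ha ih =>
    rw [Finset.mem_insert, not_or] at hT
    rw [show (fun x => x ∈ insert a T) = fun x => x = a ∨ x ∈ T from
      funext fun x => propext Finset.mem_insert, Finset.prod_insert ha, mul_comm (1 - X ^ a),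
      mul_assoc, genFun_partsIn_insert hT.2 (Ne.symm hT.1) ha, ih hT.2]

/-! ### Recurrences for the multisets on the D side -/

/-- Multisets of integers `> 2 * k` without repeated odd elements, in which every three consecutive
integers `2 * l, 2 * l + 1, 2 * l + 2` occur at most `d` times and the integers `2 * k + 1`,
`2 * k + 2` at most `i` times. -/
structure IsGapMultiset (d k i : ℕ) (s : Multiset ℕ) : Prop where
  lt_of_mem : ∀ a ∈ s, 2 * k < a
  odd_le : ∀ l, s.count (2 * l + 1) ≤ 1
  triple_le : ∀ l, s.count (2 * l) + s.count (2 * l + 1) + s.count (2 * l + 2) ≤ d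
  bottom_le : s.count (2 * k + 1) + s.count (2 * k + 2) ≤ i

/-- The set of all multisets with `IsGapMultiset d k i`. -/
def gapMultisets (d k i : ℕ) : Set (Multiset ℕ) := {s | IsGapMultiset d k i s}

lemma mem_gapMultisets {d k i : ℕ} {s : Multiset ℕ} :
    s ∈ gapMultisets d k i ↔ IsGapMultiset d k i s := Iff.rfl

lemma zero_notMem_of_mem_gapMultisets {d k i : ℕ} :
    ∀ s ∈ gapMultisets d k i, 0 ∉ s :=
  fun _ hs h => absurd (hs.lt_of_mem 0 h) (Nat.not_lt_zero _)

lemma IsGapMultiset.count_eq_zero {d k i : ℕ} {s : Multiset ℕ} (hs : IsGapMultiset d k i s)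
    {a : ℕ} (ha : a ≤ 2 * k) : s.count a = 0 :=
  Multiset.count_eq_zero.2 fun h => absurd (hs.lt_of_mem a h) (by omega)

/-- The bound `0` excludes `2k+1` and `2k+2`. The new bottom bound `d` is no restriction: it follows
from the window starting at the absent `2k+2`. -/
lemma gapMultisets_zero (d k : ℕ) : gapMultisets d k 0 = gapMultisets d (k + 1) d := by
  ext s
  constructor
  · intro hs
    refine ⟨fun a ha => ?_, hs.odd_le, hs.triple_le, ?_⟩
    · have h1 := hs.lt_of_mem a ha
      have h2 := hs.bottom_le
      have h3 := Multiset.count_pos.2 ha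
      by_contra h
      obtain rfl | rfl : a = 2 * k + 1 ∨ a = 2 * k + 2 := by omega
      · omega
      · omega
    · have := hs.triple_le (k + 1)
      rw [mul_add_one] at this ⊢
      omega
  · intro hs
    refine ⟨fun a ha => ?_, hs.odd_le, hs.triple_le, ?_⟩
    · have := hs.lt_of_mem a ha
      omega
    · rw [hs.count_eq_zero (by omega), hs.count_eq_zero (by omega)]

/-- The elements of `gapMultisets d k (i + 1)` where `2 * k + 1` occurs `e` times and
`2 * k + 2` occurs `i + 1 - e` times. -/
lemma translate_gapMultisets {i j k e f : ℕ} (he : e ≤ 1) (hef : e + f = i + 1) :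
    (· + (Multiset.replicate e (2 * k + 1) + Multiset.replicate f (2 * k + 2))) ''
        gapMultisets (i + j + 1) (k + 1) (j + e) =
      {s | s ∈ gapMultisets (i + j + 1) k (i + 1) ∧ s.count (2 * k + 1) = e ∧
        s.count (2 * k + 2) = f} := by
  have hc : ∀ a, (Multiset.replicate e (2 * k + 1) + Multiset.replicate f (2 * k + 2)).count a
      = (if a = 2 * k + 1 then e else 0) + (if a = 2 * k + 2 then f else 0) := by
    intro a
    rw [Multiset.count_add, Multiset.count_replicate, Multiset.count_replicate]
    simp only [eq_comm]
  ext s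
  constructor
  · rintro ⟨t, ht, rfl⟩
    have h0 : ∀ a, a ≤ 2 * k + 2 → t.count a = 0 := fun a ha => ht.count_eq_zero (by omega)
    have h1 := h0 (2 * k + 1) (by omega)
    have h2 := h0 (2 * k + 2) (by omega)
    refine ⟨⟨fun a ha => ?_, fun l => ?_, fun l => ?_, ?_⟩, ?_, ?_⟩
    · rcases Multiset.mem_add.1 ha with h | h
      · have := ht.lt_of_mem a h
        omega
      · rcases Multiset.mem_add.1 h with h | h <;> have := Multiset.eq_of_mem_replicate h <;> omega
    · rw [Multiset.count_add, hc]
      have := ht.odd_le l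
      by_cases hl : l = k
      · subst hl
        simp [h1, he]
      · rw [if_neg (by omega), if_neg (by omega)]
        exact this
    · simp only [Multiset.count_add, hc]
      have := ht.triple_le l
      have hb := ht.bottom_le
      rcases lt_trichotomy l k with hl | rfl | hl
      · rw [if_neg (by omega), if_neg (by omega), if_neg (by omega), if_neg (by omega),
          if_neg (by omega), if_neg (by omega)]
        exact this
      · rw [h0 (2 * l) (by omega), h1, h2]
        simp
        omega
      · obtain rfl | hl : l = k + 1 ∨ k + 1 < l := by omega
        · rw [h0 (2 * (k + 1)) (by omega), if_neg (by omega), if_pos (by omega), if_neg (by omega),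
            if_neg (by omega), if_neg (by omega), if_neg (by omega)]
          omega
        · rw [if_neg (by omega), if_neg (by omega), if_neg (by omega), if_neg (by omega),
            if_neg (by omega), if_neg (by omega)]
          exact this
    · simp only [Multiset.count_add, hc]
      rw [h1, h2]
      simp
      omega
    · rw [Multiset.count_add, hc, h1]
      simp
    · rw [Multiset.count_add, hc, h2]
      simp
  · rintro ⟨hs, h1, h2⟩
    have hle : Multiset.replicate e (2 * k + 1) + Multiset.replicate f (2 * k + 2) ≤ s := by
      rw [Multiset.le_iff_count]
      intro a
      rw [hc]
      by_cases ha : a = 2 * k + 1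
      · subst ha
        simp [h1]
      · by_cases ha' : a = 2 * k + 2
        · subst ha'
          simp [h2]
        · simp [ha, ha']
    have hcs : ∀ a, (s - (Multiset.replicate e (2 * k + 1) +
        Multiset.replicate f (2 * k + 2))).count a ≤ s.count a := fun a => by
      rw [Multiset.count_sub]
      exact Nat.sub_le _ _
    refine ⟨s - (Multiset.replicate e (2 * k + 1) + Multiset.replicate f (2 * k + 2)),
      ⟨fun a ha => ?_, fun l => (hcs _).trans (hs.odd_le l), fun l => ?_, ?_⟩,
      Multiset.sub_add_cancel hle⟩
    · have hp := Multiset.count_pos.2 ha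
      have := hs.lt_of_mem a (Multiset.mem_of_le (Multiset.sub_le_self _ _) ha)
      by_contra h
      rw [Multiset.count_sub, hc] at hp
      obtain rfl | rfl : a = 2 * k + 1 ∨ a = 2 * k + 2 := by omega
      · simp [h1] at hp
      · simp [h2] at hp
    · exact (add_le_add (add_le_add (hcs _) (hcs _)) (hcs _)).trans (hs.triple_le l)
    · have := hs.triple_le (k + 1)
      have h3 := hcs (2 * (k + 1) + 1)
      have h4 := hcs (2 * (k + 1) + 2)
      rw [show s.count (2 * (k + 1)) = f from h2] at this
      omega

/-- Either at most `i` parts are `2k+1` or `2k+2`, or exactly `i + 1` are; then the odd one, which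
cannot repeat, occurs zero times or once. The powers of `X` are the weights of the removed bottom
parts. -/
lemma genFun_gapMultisets_succ (i j k : ℕ) :
    genFun (gapMultisets (i + j + 1) k (i + 1)) =
      genFun (gapMultisets (i + j + 1) k i) +
        X ^ (2 * (k + 1) * (i + 1)) * genFun (gapMultisets (i + j + 1) (k + 1) j) +
        X ^ (2 * (k + 1) * i + 2 * k + 1) * genFun (gapMultisets (i + j + 1) (k + 1) (j + 1)) := by
  have hA := translate_gapMultisets (i := i) (j := j) (k := k) (zero_le_one) (zero_add (i + 1))
  have hB := translate_gapMultisets (i := i) (j := j) (k := k) le_rfl (add_comm 1 i)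
  have gA := congrArg genFun hA
  have gB := congrArg genFun hB
  rw [genFun_translate] at gA gB
  simp only [Multiset.sum_add, Multiset.sum_replicate, smul_eq_mul] at gA gB
  rw [show 2 * (k + 1) * (i + 1) = 0 * (2 * k + 1) + (i + 1) * (2 * k + 2) by ring,
    show 2 * (k + 1) * i + 2 * k + 1 = 1 * (2 * k + 1) + i * (2 * k + 2) by ring]
  rw [add_zero] at gA
  rw [gA, gB, ← genFun_union, ← genFun_union]
  · congr 1
    ext s
    simp only [Set.mem_union, Set.mem_ofPred_eq]
    constructor
    · intro hs
      have h1 := hs.odd_le k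
      have h2 := hs.bottom_le
      by_cases h : s.count (2 * k + 1) + s.count (2 * k + 2) ≤ i
      · exact Or.inl (Or.inl ⟨hs.lt_of_mem, hs.odd_le, hs.triple_le, h⟩)
      · by_cases h0 : s.count (2 * k + 1) = 0
        · exact Or.inl (Or.inr ⟨hs, h0, by omega⟩)
        · exact Or.inr ⟨hs, by omega, by omega⟩
    · rintro ((hs | hs) | hs)
      · exact ⟨hs.lt_of_mem, hs.odd_le, hs.triple_le, hs.bottom_le.trans (Nat.le_succ i)⟩
      · exact hs.1
      · exact hs.1
  · rintro s (hs | hs)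
    · exact zero_notMem_of_mem_gapMultisets s hs
    · exact zero_notMem_of_mem_gapMultisets s hs.1
  · exact fun s hs => zero_notMem_of_mem_gapMultisets s hs.1
  · rw [Set.disjoint_left]
    rintro s (hs | hs) hs'
    · have := hs.bottom_le
      have := hs'.2
      omega
    · have := hs.2
      have := hs'.2
      omega
  · exact zero_notMem_of_mem_gapMultisets
  · exact fun s hs => zero_notMem_of_mem_gapMultisets s hs.1
  · rw [Set.disjoint_left]
    intro s hs hs'
    have := hs.bottom_le
    have := hs'.2
    omega

lemma coeff_genFun_gapMultisets_of_le {d k i n : ℕ} (h : n ≤ 2 * k) :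
    coeff n (genFun (gapMultisets d k i)) = coeff n (1 : ℤ⟦X⟧) := by
  rw [← genFun_singleton_zero]
  refine coeff_genFun_congr fun s hs => ?_
  rw [Set.mem_singleton_iff]
  constructor
  · intro h'
    rw [Multiset.eq_zero_iff_forall_notMem]
    intro a ha
    have h1 := h'.lt_of_mem a ha
    have h2 := Multiset.le_sum_of_mem ha
    omega
  · rintro rfl
    exact ⟨by simp, by simp, by simp, by simp⟩

/-! ### Andrews' series and its recurrences -/

section Series

variable {R : Type*} [CommRing R]

/-- The product `∏ l < k, (1 - q ^ (2 (n + l + 1)))`. -/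
def evenProd (q : R) (k n : ℕ) : R := ∏ l ∈ Finset.range k, (1 - q ^ (2 * (n + l + 1)))

/-- The product `∏ l < k, g (n + l)`. -/
def shiftProd (g : ℕ → R) (k n : ℕ) : R := ∏ l ∈ Finset.range k, g (n + l)

lemma evenProd_succ (q : R) (k n : ℕ) :
    evenProd q (k + 1) n = evenProd q k n * (1 - q ^ (2 * (n + k + 1))) :=
  Finset.prod_range_succ _ _

lemma evenProd_succ' (q : R) (k n : ℕ) :
    evenProd q (k + 1) n = evenProd q k (n + 1) * (1 - q ^ (2 * (n + 1))) := by
  rw [evenProd, Finset.prod_range_succ', evenProd]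
  congr 1
  exact Finset.prod_congr rfl fun l _ => by rw [add_right_comm n 1 l, add_assoc n l 1]

lemma shiftProd_succ (g : ℕ → R) (k n : ℕ) :
    shiftProd g (k + 1) n = shiftProd g k n * g (n + k) :=
  Finset.prod_range_succ _ _

lemma shiftProd_succ' (g : ℕ → R) (k n : ℕ) :
    shiftProd g (k + 1) n = shiftProd g k (n + 1) * g n := by
  rw [shiftProd, Finset.prod_range_succ', shiftProd]
  congr 1
  exact Finset.prod_congr rfl fun l _ => by rw [add_right_comm n 1 l, add_assoc n l 1]

/-- The terms of Andrews' series `J_{r,i+1}(-1/q; q^{2k}; q²)`, `r = i + j + 1`, divided by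
`(-q;q²)_∞ / (q²;q²)_∞`; the function `g` stands for `m ↦ (1 + q ^ (2m + 1))⁻¹`. -/
def term (q : R) (g : ℕ → R) (k j i n : ℕ) : R :=
  (-1) ^ n * (q ^ (2 * n * ((i + j + 1) * (n + k) + j) + n) * (evenProd q k n * shiftProd g k n) -
    q ^ (2 * n * (i + j + 1) * (n + k + 1) + (2 * i + 1) * n + 2 * i * (k + 1) + 2 * k + 1) *
      (evenProd q k n * shiftProd g k (n + 1)))

/-- Partial sums of Andrews' series. -/
def series (q : R) (g : ℕ → R) (M k j i : ℕ) : R := ∑ n ∈ Finset.range M, term q g k j i n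

variable {q : R} {g : ℕ → R}

/-- The defect of the recurrence in the `n`-th terms has the form `F n - F (n + 1)`, so it
telescopes under summation. -/
lemma term_succ_sub (hg : ∀ m, (1 + q ^ (2 * m + 1)) * g m = 1) (k j i n : ℕ) :
    term q g k j (i + 1) n - term q g k (j + 1) i n -
        q ^ (2 * (k + 1) * (i + 1)) * term q g (k + 1) (i + 1) j n -
        q ^ (2 * (k + 1) * i + 2 * k + 1) * term q g (k + 1) i (j + 1) n =
      (-1) ^ n * q ^ (2 * n * ((i + j + 2) * (n + k) + j) + n) *
          ((1 - q ^ (2 * n)) * (evenProd q k n * shiftProd g k n)) -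
      (-1) ^ (n + 1) * q ^ (2 * (n + 1) * ((i + j + 2) * (n + 1 + k) + j) + (n + 1)) *
          ((1 - q ^ (2 * (n + 1))) * (evenProd q k (n + 1) * shiftProd g k (n + 1))) := by
  have e1 := evenProd_succ q k n
  have e2 := evenProd_succ' q k n
  have s1 : (1 + q ^ (2 * n + 1)) * shiftProd g (k + 1) n = shiftProd g k (n + 1) := by
    rw [shiftProd_succ']
    linear_combination shiftProd g k (n + 1) * hg n
  have s2 : (1 + q ^ (2 * (n + 1 + k) + 1)) * shiftProd g (k + 1) (n + 1) =
      shiftProd g k (n + 1) := by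
    rw [shiftProd_succ]
    linear_combination shiftProd g k (n + 1) * hg (n + 1 + k)
  have e3 : (1 - q ^ (2 * (n + 1))) * evenProd q k (n + 1) = evenProd q (k + 1) n := by
    rw [e2, mul_comm]
  rw [← mul_assoc (1 - q ^ (2 * (n + 1))), e3]
  unfold term
  generalize evenProd q (k + 1) n = E' at *
  generalize evenProd q k n = E at *
  generalize shiftProd g (k + 1) n = S1 at *
  generalize shiftProd g (k + 1) (n + 1) = S2 at *
  generalize shiftProd g k (n + 1) = S at *
  generalize shiftProd g k n = S0 at *
  -- Second halves of the two terms at `k`: their exponents differ by `2(n+k+1)`, the factor that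
  -- extends `E` to `E'`. The first halves of these terms give `F n` directly.
  have p1 : q ^ (2 * n * (i + (j + 1) + 1) * (n + k + 1) + (2 * i + 1) * n + 2 * i * (k + 1) +
      2 * k + 1) * E - q ^ (2 * n * (i + 1 + j + 1) * (n + k + 1) + (2 * (i + 1) + 1) * n +
      2 * (i + 1) * (k + 1) + 2 * k + 1) * E =
      q ^ (2 * n * (i + (j + 1) + 1) * (n + k + 1) + (2 * i + 1) * n + 2 * i * (k + 1) +
      2 * k + 1) * E' := by
    rw [e1]
    ring
  -- First halves of the two terms at `k + 1`: they combine through `1 + q^(2n+1)` and cancel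
  -- against `p1`.
  have p2 : q ^ (2 * (k + 1) * (i + 1)) * q ^ (2 * n * ((j + (i + 1) + 1) * (n + (k + 1)) +
        (i + 1)) + n) * S1 +
      q ^ (2 * (k + 1) * i + 2 * k + 1) * q ^ (2 * n * ((j + 1 + i + 1) * (n + (k + 1)) + i) + n)
        * S1 =
      q ^ (2 * n * (i + (j + 1) + 1) * (n + k + 1) + (2 * i + 1) * n + 2 * i * (k + 1) +
      2 * k + 1) * S := by
    rw [← s1]
    ring
  -- Second halves of the terms at `k + 1`: what remains is `F (n + 1)`.
  have p3 : q ^ (2 * (k + 1) * (i + 1)) * q ^ (2 * n * (j + (i + 1) + 1) * (n + (k + 1) + 1) +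
        (2 * j + 1) * n + 2 * j * (k + 1 + 1) + 2 * (k + 1) + 1) * S2 +
      q ^ (2 * (k + 1) * i + 2 * k + 1) * q ^ (2 * n * (j + 1 + i + 1) * (n + (k + 1) + 1) +
        (2 * (j + 1) + 1) * n + 2 * (j + 1) * (k + 1 + 1) + 2 * (k + 1) + 1) * S2 =
      q ^ (2 * (n + 1) * ((i + j + 2) * (n + 1 + k) + j) + (n + 1)) * S := by
    rw [← s2]
    ring
  linear_combination (-1) ^ n * S * p1 - (-1) ^ n * E' * p2 + (-1) ^ n * E' * p3

lemma term_zero_sub (hg : ∀ m, (1 + q ^ (2 * m + 1)) * g m = 1) (k j n : ℕ) :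
    term q g k j 0 n - term q g (k + 1) 0 j n =
      (-1) ^ n * q ^ (2 * n * ((j + 1) * (n + k) + j) + n) *
          ((1 - q ^ (2 * n)) * (evenProd q k n * shiftProd g (k + 1) n)) -
      (-1) ^ (n + 1) * q ^ (2 * (n + 1) * ((j + 1) * (n + 1 + k) + j) + (n + 1)) *
          ((1 - q ^ (2 * (n + 1))) * (evenProd q k (n + 1) * shiftProd g (k + 1) (n + 1))) := by
  have e1 := evenProd_succ q k n
  have e3 : (1 - q ^ (2 * (n + 1))) * evenProd q k (n + 1) = evenProd q (k + 1) n := by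
    rw [evenProd_succ' q k n, mul_comm]
  have s1 : (1 + q ^ (2 * (n + k) + 1)) * shiftProd g (k + 1) n = shiftProd g k n := by
    rw [shiftProd_succ]
    linear_combination shiftProd g k n * hg (n + k)
  have s2 : (1 + q ^ (2 * n + 1)) * shiftProd g (k + 1) n = shiftProd g k (n + 1) := by
    rw [shiftProd_succ']
    linear_combination shiftProd g k (n + 1) * hg n
  rw [← mul_assoc (1 - q ^ (2 * (n + 1))), e3]
  unfold term
  rw [← s1, ← s2, e1]
  generalize evenProd q k n = E at *
  generalize shiftProd g (k + 1) n = S1 at *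
  generalize shiftProd g (k + 1) (n + 1) = S2 at *
  ring

lemma series_succ (hg : ∀ m, (1 + q ^ (2 * m + 1)) * g m = 1) {M : ℕ} (hM : ∀ m, M ≤ m → q ^ m = 0)
    (k j i : ℕ) :
    series q g M k j (i + 1) = series q g M k (j + 1) i +
        q ^ (2 * (k + 1) * (i + 1)) * series q g M (k + 1) (i + 1) j +
        q ^ (2 * (k + 1) * i + 2 * k + 1) * series q g M (k + 1) i (j + 1) := by
  have h := Finset.sum_congr (rfl : Finset.range M = Finset.range M) fun n _ =>
    term_succ_sub hg k j i n
  -- The boundary term at `n = 0` carries the factor `1 - q^0 = 0`; the one at `n = M` carries a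
  -- power of `q` with exponent at least `M`.
  rw [Finset.sum_range_sub' (fun n => (-1) ^ n * q ^ (2 * n * ((i + j + 2) * (n + k) + j) + n) *
          ((1 - q ^ (2 * n)) * (evenProd q k n * shiftProd g k n))) M,
    hM (2 * M * ((i + j + 2) * (M + k) + j) + M) (by omega)] at h
  simp only [Finset.sum_sub_distrib, ← Finset.mul_sum] at h
  unfold series
  linear_combination h

lemma series_zero (hg : ∀ m, (1 + q ^ (2 * m + 1)) * g m = 1) {M : ℕ} (hM : ∀ m, M ≤ m → q ^ m = 0)
    (k j : ℕ) : series q g M k j 0 = series q g M (k + 1) 0 j := by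
  have h := Finset.sum_congr (rfl : Finset.range M = Finset.range M) fun n _ =>
    term_zero_sub hg k j n
  rw [Finset.sum_range_sub' (fun n => (-1) ^ n * q ^ (2 * n * ((j + 1) * (n + k) + j) + n) *
          ((1 - q ^ (2 * n)) * (evenProd q k n * shiftProd g (k + 1) n))) M,
    hM (2 * M * ((j + 1) * (M + k) + j) + M) (by omega)] at h
  simp only [Finset.sum_sub_distrib] at h
  unfold series
  linear_combination h

lemma shiftProd_stable {M : ℕ} (hg : ∀ m, M ≤ m → g m = 1) (k : ℕ) :
    shiftProd g (M + k) 0 = shiftProd g M 0 := by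
  rw [shiftProd, Finset.prod_range_add, shiftProd]
  refine (congrArg _ (Finset.prod_eq_one ?_)).trans (mul_one _)
  exact fun l _ => hg _ (by omega)

lemma evenProd_stable {M : ℕ} (hM : ∀ m, M ≤ m → q ^ m = 0) (k : ℕ) :
    evenProd q (M + k) 0 = evenProd q M 0 := by
  rw [evenProd, Finset.prod_range_add, evenProd]
  refine (congrArg _ (Finset.prod_eq_one ?_)).trans (mul_one _)
  exact fun l _ => by rw [hM _ (by omega), sub_zero]

/-- For a base index of at least `M`, every exponent other than that of the first half of the term
`n = 0` is at least `M`, so only this half survives. -/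
lemma series_of_le (hg : ∀ m, (1 + q ^ (2 * m + 1)) * g m = 1) {M : ℕ}
    (hM : ∀ m, M ≤ m → q ^ m = 0) (k j i : ℕ) :
    series q g M (M + k) j i = evenProd q M 0 * shiftProd g M 0 := by
  have hg1 : ∀ m, M ≤ m → g m = 1 := fun m hm => by
    have := hg m
    rwa [hM _ (by omega), add_zero, one_mul] at this
  rcases Nat.eq_zero_or_pos M with rfl | hpos
  · have h1 : (1 : R) = 0 := by simpa using hM 0 le_rfl
    exact eq_of_zero_eq_one h1.symm _ _
  · rw [series, Finset.sum_eq_single_of_mem 0 (Finset.mem_range.2 hpos)]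
    · rw [term, hM (2 * 0 * (i + j + 1) * (0 + (M + k) + 1) + (2 * i + 1) * 0 +
        2 * i * (M + k + 1) + 2 * (M + k) + 1) (by omega), evenProd_stable hM,
        shiftProd_stable hg1]
      simp
    · intro n _ hn
      obtain ⟨n, rfl⟩ := Nat.exists_eq_succ_of_ne_zero hn
      have h2 : M ≤ 2 * (n + 1) * ((i + j + 1) * (n + 1 + (M + k)) + j) + (n + 1) := by
        nlinarith [Nat.zero_le ((i + j) * (n + 1 + (M + k))), Nat.zero_le (n * j),
          Nat.zero_le (n * (i + j + 1) * (n + 1 + (M + k)))]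
      rw [term, hM _ h2, hM (2 * (n + 1) * (i + j + 1) * (n + 1 + (M + k) + 1) +
        (2 * i + 1) * (n + 1) + 2 * i * (M + k + 1) + 2 * (M + k) + 1) (by omega)]
      simp

end Series

/-! ### The D generating function as Andrews' series -/

section Reduction

variable {R : Type*} [CommRing R] {φ : ℤ⟦X⟧ →+* R} {M : ℕ}

lemma map_eq_of_coeff_eq (hM : ∀ m, M ≤ m → φ X ^ m = 0) {a b : ℤ⟦X⟧}
    (h : ∀ n < M, coeff n a = coeff n b) : φ a = φ b := by
  obtain ⟨c, hc⟩ := (X_pow_dvd_iff (φ := a - b)).2 fun n hn => by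
    rw [map_sub, h n hn, sub_self]
  rw [← sub_eq_zero, ← map_sub, hc, map_mul, map_pow, hM M le_rfl, zero_mul]

/-- Both sides obey the same recurrences and agree for `k ≥ M`. Downward induction on `k`, then
induction on `i` with `j` free, since the recurrence trades `i` for `j`. -/
lemma map_genFun_gapMultisets_mul (hM : ∀ m, M ≤ m → φ X ^ m = 0) {g : ℕ → R}
    (hg : ∀ m, (1 + φ X ^ (2 * m + 1)) * g m = 1) (k j i : ℕ) :
    φ (genFun (gapMultisets (i + j) k i)) * (evenProd (φ X) M 0 * shiftProd g M 0) =
      series (φ X) g M k j i := by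
  suffices H : ∀ d k, M ≤ k + d → ∀ i j,
      φ (genFun (gapMultisets (i + j) k i)) * (evenProd (φ X) M 0 * shiftProd g M 0) =
        series (φ X) g M k j i from H M k (Nat.le_add_left _ _) i j
  intro d
  induction d with
  | zero =>
    intro k hk i j
    obtain ⟨k, rfl⟩ := Nat.exists_eq_add_of_le (show M ≤ k from hk)
    rw [series_of_le hg hM, map_eq_of_coeff_eq hM fun n hn =>
      coeff_genFun_gapMultisets_of_le (show n ≤ 2 * (M + k) by omega), map_one, one_mul]
  | succ d ih =>
    intro k hk i
    have ih' := ih (k + 1) (by omega)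
    induction i with
    | zero =>
      intro j
      rw [series_zero hg hM, ← ih', gapMultisets_zero, zero_add, add_zero]
    | succ i ihi =>
      intro j
      rw [series_succ hg hM, ← ih', ← ih', ← ihi, show i + 1 + j = i + j + 1 by omega,
        genFun_gapMultisets_succ, map_add, map_add, map_mul, map_mul, map_pow, map_pow,
        show j + (i + 1) = i + j + 1 by omega, show j + 1 + i = i + j + 1 by omega,
        show i + (j + 1) = i + j + 1 by omega]
      ring

end Reduction

/-! ### Gaussian binomials and the finite Jacobi triple product -/

section JacobiTripleProduct

variable {R : Type*} [CommRing R]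

/-- The product `(p; p)_n = ∏ m < n, (1 - p ^ (m + 1))`. -/
def qFactorial (p : R) (n : ℕ) : R := ∏ m ∈ Finset.range n, (1 - p ^ (m + 1))

/-- The Gaussian binomial coefficient `a + b` over `b`, in base `p`. -/
def gaussBinom (p : R) : ℕ → ℕ → R
  | 0, _ => 1
  | _ + 1, 0 => 1
  | a + 1, b + 1 => gaussBinom p a (b + 1) + p ^ (a + 1) * gaussBinom p (a + 1) b

lemma gaussBinom_zero_left (p : R) (b : ℕ) : gaussBinom p 0 b = 1 := by
  rw [gaussBinom]

lemma gaussBinom_zero_right (p : R) (a : ℕ) : gaussBinom p a 0 = 1 := by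
  cases a <;> rw [gaussBinom]

lemma gaussBinom_succ_succ (p : R) (a b : ℕ) :
    gaussBinom p (a + 1) (b + 1) =
      gaussBinom p a (b + 1) + p ^ (a + 1) * gaussBinom p (a + 1) b := by
  rw [gaussBinom]

lemma qFactorial_zero (p : R) : qFactorial p 0 = 1 := Finset.prod_range_zero _

lemma qFactorial_succ (p : R) (n : ℕ) :
    qFactorial p (n + 1) = qFactorial p n * (1 - p ^ (n + 1)) := Finset.prod_range_succ _ _

lemma gaussBinom_mul (p : R) (a b : ℕ) :
    gaussBinom p a b * (qFactorial p a * qFactorial p b) = qFactorial p (a + b) := by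
  induction a generalizing b with
  | zero => rw [gaussBinom_zero_left, qFactorial_zero, zero_add, one_mul, one_mul]
  | succ a iha =>
    induction b with
    | zero => rw [gaussBinom_zero_right, qFactorial_zero, add_zero, one_mul, mul_one]
    | succ b ihb =>
      have h1 := iha (b + 1)
      rw [gaussBinom_succ_succ, show a + 1 + (b + 1) = a + b + 1 + 1 by omega, qFactorial_succ p
        (a + b + 1)]
      rw [show a + (b + 1) = a + b + 1 by omega] at h1
      rw [show a + 1 + b = a + b + 1 by omega] at ihb
      rw [qFactorial_succ] at ihb h1 ⊢
      rw [qFactorial_succ p b]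
      linear_combination (1 - p ^ (a + 1)) * h1 + p ^ (a + 1) * (1 - p ^ (b + 1)) * ihb

/-- The defining recursion is not symmetric; symmetry comes from the factorial formula by
cancellation, hence the domain and the condition on `p`. -/
lemma gaussBinom_comm [IsDomain R] {p : R} (hp : ∀ m, p ^ (m + 1) ≠ 1) (a b : ℕ) :
    gaussBinom p a b = gaussBinom p b a := by
  have h : ∀ n, qFactorial p n ≠ 0 := fun n =>
    Finset.prod_ne_zero_iff.2 fun m _ => sub_ne_zero.2 (hp m).symm
  refine mul_right_cancel₀ (mul_ne_zero (h a) (h b)) ?_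
  rw [gaussBinom_mul, mul_comm (qFactorial p a), gaussBinom_mul, add_comm]

/-- Pascal's rule summed against a weight. It is the induction step of the finite triple product,
where one more factor multiplies the weight by `1 - y p^B` or `1 - x p^A`. -/
lemma sum_antidiagonal_gaussBinom (p : R) (h : ℕ → R) (n : ℕ) :
    ∑ x ∈ Finset.HasAntidiagonal.antidiagonal (n + 1), h x.2 * gaussBinom p x.1 x.2 =
      ∑ x ∈ Finset.HasAntidiagonal.antidiagonal n,
        (h x.2 + p ^ x.1 * h (x.2 + 1)) * gaussBinom p x.1 x.2 := by
  have key : ∀ a b, a + b ≠ 0 → h b * gaussBinom p a b =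
      (if a = 0 then 0 else h b * gaussBinom p (a - 1) b) +
      (if b = 0 then 0 else p ^ a * h b * gaussBinom p a (b - 1)) := by
    intro a b hab
    rcases a with _ | a <;> rcases b with _ | b
    · exact absurd rfl hab
    · simp [gaussBinom_zero_left]
    · simp [gaussBinom_zero_right]
    · simp [gaussBinom_succ_succ]
      ring
  rw [Finset.sum_congr rfl fun x hx => key x.1 x.2
    (by rw [Finset.HasAntidiagonal.mem_antidiagonal] at hx; omega), Finset.sum_add_distrib,
    Finset.Nat.sum_antidiagonal_succ, Finset.Nat.sum_antidiagonal_succ']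
  simp only [if_true, zero_add, Nat.add_one_ne_zero, if_false, Nat.add_sub_cancel]
  rw [← Finset.sum_add_distrib]
  exact Finset.sum_congr rfl fun x _ => by ring

/-- The triangular number `n (n - 1) / 2` of an integer `n`. -/
def triangle (n : ℤ) : ℕ := (n * (n - 1) / 2).toNat

lemma two_mul_triangle (n : ℤ) : 2 * (triangle n : ℤ) = n * (n - 1) := by
  have h : (2 : ℤ) ∣ n * (n - 1) := (Int.even_mul_pred_self n).two_dvd
  have h0 : 0 ≤ n * (n - 1) := by
    rcases le_or_gt n 0 with hn | hn
    · exact mul_nonneg_of_nonpos_of_nonpos hn (by omega)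
    · exact mul_nonneg hn.le (by omega)
  rw [triangle, Int.toNat_of_nonneg (Int.ediv_nonneg h0 (by norm_num)), Int.mul_ediv_cancel' h]

/-- The general term of Ramanujan's theta function `f(-y, -x)`. -/
def thetaTerm (x y : R) (n : ℤ) : R :=
  ((n.negOnePow : ℤ) : R) * (x ^ triangle n * y ^ triangle (n + 1))

/-- Consecutive theta terms have ratio `-y (xy)^n`; the exponents `a` and `b` clear denominators
when `n` is negative. -/
lemma mul_thetaTerm {x y : R} {a b : ℕ} {n : ℤ} (h : (b : ℤ) = a + n) :
    y * (x * y) ^ b * thetaTerm x y n = -((x * y) ^ a * thetaTerm x y (n + 1)) := by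
  have h0 := two_mul_triangle n
  have h1 := two_mul_triangle (n + 1)
  have h2 := two_mul_triangle (n + 1 + 1)
  have e1 : b + triangle n = a + triangle (n + 1) := by
    zify
    linarith
  have e2 : b + 1 + triangle (n + 1) = a + triangle (n + 1 + 1) := by
    zify
    linarith
  unfold thetaTerm
  rw [Int.negOnePow_succ]
  push_cast
  calc _ = ((n.negOnePow : ℤ) : R) * (x ^ (b + triangle n) * y ^ (b + 1 + triangle (n + 1))) := by
        ring
    _ = _ := by
        rw [e1, e2]
        ring

lemma mul_thetaTerm' {x y : R} {a b : ℕ} {n : ℤ} (h : (a : ℤ) = b - n) :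
    x * (x * y) ^ a * thetaTerm x y n = -((x * y) ^ b * thetaTerm x y (n - 1)) := by
  have h0 := two_mul_triangle n
  have h1 := two_mul_triangle (n + 1)
  have h2 := two_mul_triangle (n - 1)
  have e1 : a + 1 + triangle n = b + triangle (n - 1) := by
    zify
    linarith
  have e2 : a + triangle (n + 1) = b + triangle n := by
    zify
    linarith
  unfold thetaTerm
  rw [Int.negOnePow_sub, Int.negOnePow_one, sub_add_cancel]
  push_cast
  calc _ = ((n.negOnePow : ℤ) : R) * (x ^ (a + 1 + triangle n) * y ^ (a + triangle (n + 1))) := by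
        ring
    _ = _ := by
        rw [e1, e2]
        ring

/-- The finite form of the Jacobi triple product identity. -/
lemma prod_mul_prod_eq_sum_thetaTerm [IsDomain R] {x y : R} (hp : ∀ m, (x * y) ^ (m + 1) ≠ 1)
    (A B : ℕ) :
    (∏ m ∈ Finset.range A, (1 - x * (x * y) ^ m)) * ∏ m ∈ Finset.range B, (1 - y * (x * y) ^ m) =
      ∑ z ∈ Finset.HasAntidiagonal.antidiagonal (A + B),
        thetaTerm x y ((z.2 : ℤ) - A) * gaussBinom (x * y) z.1 z.2 := by
  induction B with
  | zero =>
    rw [Finset.prod_range_zero, mul_one, add_zero]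
    induction A with
    | zero => simp [thetaTerm, triangle, gaussBinom_zero_left]
    | succ A ih =>
      have hs : ∀ n : ℕ, ∑ z ∈ Finset.HasAntidiagonal.antidiagonal n,
          thetaTerm x y ((z.2 : ℤ) - n) * gaussBinom (x * y) z.1 z.2 =
          ∑ z ∈ Finset.HasAntidiagonal.antidiagonal n,
            (fun k : ℕ => thetaTerm x y (-(k : ℤ))) z.2 * gaussBinom (x * y) z.1 z.2 := by
        intro n
        rw [← Finset.Nat.sum_antidiagonal_swap]
        refine Finset.sum_congr rfl fun z hz => ?_
        rw [Finset.HasAntidiagonal.mem_antidiagonal] at hz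
        rw [Prod.fst_swap, Prod.snd_swap, gaussBinom_comm hp,
          show ((z.1 : ℕ) : ℤ) - n = -(z.2 : ℤ) by omega]
      rw [Finset.prod_range_succ, ih, hs, hs,
        sum_antidiagonal_gaussBinom (x * y) (fun k : ℕ => thetaTerm x y (-(k : ℤ))), Finset.sum_mul]
      refine Finset.sum_congr rfl fun z hz => ?_
      rw [Finset.HasAntidiagonal.mem_antidiagonal] at hz
      have := mul_thetaTerm' (x := x) (y := y) (show (A : ℤ) = z.1 - (-(z.2 : ℤ)) by omega)
      simp only
      rw [show (-((z.2 + 1 : ℕ) : ℤ)) = -(z.2 : ℤ) - 1 by omega]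
      linear_combination -gaussBinom (x * y) z.1 z.2 * this
  | succ B ih =>
    rw [Finset.prod_range_succ, ← mul_assoc, ih, ← add_assoc,
      sum_antidiagonal_gaussBinom (x * y) (fun k : ℕ => thetaTerm x y ((k : ℤ) - A)),
      Finset.sum_mul]
    refine Finset.sum_congr rfl fun z hz => ?_
    rw [Finset.HasAntidiagonal.mem_antidiagonal] at hz
    have := mul_thetaTerm (x := x) (y := y) (show (B : ℤ) = z.1 + ((z.2 : ℤ) - A) by omega)
    rw [show ((z.2 + 1 : ℕ) : ℤ) - A = (z.2 : ℤ) - A + 1 by omega]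
    linear_combination -gaussBinom (x * y) z.1 z.2 * this

end JacobiTripleProduct

/-! ### The triple product and the theta series for nilpotent `q` -/

section Reduction

variable {R : Type*} [CommRing R]

lemma map_gaussBinom {S : Type*} [CommRing S] (φ : S →+* R) (p : S) (a b : ℕ) :
    φ (gaussBinom p a b) = gaussBinom (φ p) a b := by
  induction a generalizing b with
  | zero => rw [gaussBinom_zero_left, gaussBinom_zero_left, map_one]
  | succ a iha =>
    induction b with
    | zero => rw [gaussBinom_zero_right, gaussBinom_zero_right, map_one]
    | succ b ihb =>
      rw [gaussBinom_succ_succ, gaussBinom_succ_succ, map_add, map_mul, map_pow, iha, ihb]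

lemma map_thetaTerm {S : Type*} [CommRing S] (φ : S →+* R) (x y : S) (n : ℤ) :
    φ (thetaTerm x y n) = thetaTerm (φ x) (φ y) n := by
  simp [thetaTerm]

variable {q : R} {M : ℕ}

lemma isUnit_one_sub_pow (hM : ∀ m, M ≤ m → q ^ m = 0) {m : ℕ} (hm : m ≠ 0) :
    IsUnit (1 - q ^ m) :=
  (IsNilpotent.pow_of_pos ⟨M, hM M le_rfl⟩ hm).isUnit_one_sub

lemma prod_one_sub_pow_stable (hM : ∀ m, M ≤ m → q ^ m = 0) {f : ℕ → ℕ} (hf : ∀ m, m ≤ f m)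
    {N : ℕ} (hN : M ≤ N) :
    ∏ m ∈ Finset.range N, (1 - q ^ f m) = ∏ m ∈ Finset.range M, (1 - q ^ f m) :=
  Finset.eventually_constant_prod (fun m hm => by rw [hM _ (hm.trans (hf m)), sub_zero]) hN

/-- The exponent is at least `triangle n + triangle (n + 1) = n²`, hence at least `|n|`. -/
lemma thetaTerm_eq_zero (hM : ∀ m, M ≤ m → q ^ m = 0) {b c : ℕ} (hb : b ≠ 0) (hc : c ≠ 0)
    {n : ℤ} (hn : (M : ℤ) ≤ |n|) : thetaTerm (q ^ b) (q ^ c) n = 0 := by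
  have h0 := two_mul_triangle n
  have h1 := two_mul_triangle (n + 1)
  have h2 : M ≤ b * triangle n + c * triangle (n + 1) := by
    have h3 : triangle n ≤ b * triangle n := Nat.le_mul_of_pos_left _ (Nat.pos_of_ne_zero hb)
    have h4 : triangle (n + 1) ≤ c * triangle (n + 1) :=
      Nat.le_mul_of_pos_left _ (Nat.pos_of_ne_zero hc)
    have h5 : (triangle n : ℤ) + triangle (n + 1) = n ^ 2 := by linarith
    have h6 : |n| ≤ n ^ 2 := by
      rw [← sq_abs]
      exact Int.le_self_sq _
    omega
  rw [thetaTerm, ← pow_mul, ← pow_mul, ← pow_add, hM _ h2, mul_zero]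

/-- The Jacobi triple product identity modulo a power of `q`. -/
lemma jacobi_triple_product_nilpotent {φ : ℤ⟦X⟧ →+* R} (hq : φ X = q)
    (hM : ∀ m, M ≤ m → q ^ m = 0) {b c : ℕ} (hb : b ≠ 0) (hc : c ≠ 0) :
    (∏ m ∈ Finset.range M, (1 - q ^ (b + (b + c) * m))) *
        (∏ m ∈ Finset.range M, (1 - q ^ (c + (b + c) * m))) *
        ∏ m ∈ Finset.range M, (1 - q ^ ((b + c) * (m + 1))) =
      ∑ n ∈ Finset.range M,
        (thetaTerm (q ^ b) (q ^ c) n + thetaTerm (q ^ b) (q ^ c) (-(n : ℤ) - 1)) := by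
  have hbc : 0 < b + c := by omega
  have hle : ∀ m, m ≤ (b + c) * m := fun m => Nat.le_mul_of_pos_left _ hbc
  have hne : ∀ m, ((X : ℤ⟦X⟧) ^ b * X ^ c) ^ (m + 1) ≠ 1 := by
    intro m h
    have := congrArg constantCoeff h
    rw [← pow_add, ← pow_mul, map_pow, constantCoeff_X, map_one,
      zero_pow (Nat.mul_ne_zero (by omega) (by omega))] at this
    exact zero_ne_one this
  -- With `2M` factors on each side, an index with `|n| < M` has both Gaussian arguments above `M`,
  -- where the binomial is the inverse of `Z`. All other theta terms vanish.
  have key := congrArg φ (prod_mul_prod_eq_sum_thetaTerm hne (2 * M) (2 * M))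
  simp only [map_mul, map_prod, map_sum, map_sub, map_one, map_pow, map_gaussBinom, map_thetaTerm,
    hq, ← pow_add, ← pow_mul] at key
  have hst : ∀ d, ∏ m ∈ Finset.range (2 * M), (1 - q ^ (d + (b + c) * m)) =
      ∏ m ∈ Finset.range M, (1 - q ^ (d + (b + c) * m)) := fun d =>
    prod_one_sub_pow_stable hM (fun m => (hle m).trans (Nat.le_add_left _ _)) (by omega)
  rw [hst, hst] at key
  set Z := ∏ m ∈ Finset.range M, (1 - q ^ ((b + c) * (m + 1))) with hZ
  have hfac : ∀ a, M ≤ a → qFactorial (q ^ (b + c)) a = Z := by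
    intro a ha
    unfold qFactorial
    simp only [← pow_mul]
    exact prod_one_sub_pow_stable hM (fun m => (Nat.le_succ m).trans (hle (m + 1))) ha
  have hunit : IsUnit Z := by
    rw [hZ, IsUnit.prod_iff]
    exact fun m _ => isUnit_one_sub_pow hM (Nat.mul_ne_zero (by omega) (by omega))
  have hG : ∀ a b', M ≤ a → M ≤ b' → gaussBinom (q ^ (b + c)) a b' * Z = 1 := by
    intro a b' ha hb'
    have h := gaussBinom_mul (q ^ (b + c)) a b'
    rw [hfac a ha, hfac b' hb', hfac _ (ha.trans (Nat.le_add_right _ _)), ← mul_assoc] at h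
    exact hunit.mul_right_cancel (h.trans (one_mul Z).symm)
  rw [key, Finset.sum_mul]
  have hterm : ∀ z ∈ Finset.HasAntidiagonal.antidiagonal (2 * M + 2 * M),
      thetaTerm (q ^ b) (q ^ c) ((z.2 : ℤ) - (2 * M : ℕ)) * gaussBinom (q ^ (b + c)) z.1 z.2 * Z =
        (fun s _ : ℕ => thetaTerm (q ^ b) (q ^ c) ((2 * M : ℕ) - (s : ℤ))) z.1 z.2 := by
    intro z hz
    rw [Finset.HasAntidiagonal.mem_antidiagonal] at hz
    simp only
    rw [show ((2 * M : ℕ) : ℤ) - (z.1 : ℤ) = (z.2 : ℤ) - (2 * M : ℕ) by omega]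
    by_cases h : (M : ℤ) ≤ |(z.2 : ℤ) - (2 * M : ℕ)|
    · rw [thetaTerm_eq_zero hM hb hc h, zero_mul, zero_mul]
    · rw [not_le, abs_lt] at h
      rw [mul_assoc, hG _ _ (by omega) (by omega), mul_one]
  -- The indices `n = 2M, …, -2M` are split into `n ≥ 0` and `n < 0`; both ranges are then cut down
  -- to `M` terms.
  rw [Finset.sum_congr rfl hterm, Finset.Nat.sum_antidiagonal_eq_sum_range_succ
    (fun s _ : ℕ => thetaTerm (q ^ b) (q ^ c) ((2 * M : ℕ) - (s : ℤ))),
    show (2 * M + 2 * M).succ = (2 * M + 1) + 2 * M by omega, Finset.sum_range_add,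
    Finset.sum_add_distrib]
  congr 1
  · rw [← Finset.eventually_constant_sum (N := M) (n := 2 * M + 1)
      (fun n hn => thetaTerm_eq_zero hM hb hc (le_abs.2 (by omega))) (by omega), ← Finset.sum_range_reflect]
    refine Finset.sum_congr rfl fun n hn => ?_
    rw [Finset.mem_range] at hn
    congr 1
    omega
  · rw [← Finset.eventually_constant_sum (N := M) (n := 2 * M)
      (fun n hn => thetaTerm_eq_zero hM hb hc (le_abs.2 (by omega))) (by omega)]
    refine Finset.sum_congr rfl fun n hn => ?_
    congr 1
    omega

/-- At `k = 0` the products in the first half are reciprocal, up to the factor `g` absorbed in the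
second: no such factor survives, so the halves are the theta terms of index `n` and `-n - 1`. -/
lemma term_zero_eq_thetaTerm (q : R) (g : ℕ → R) (j i n : ℕ) :
    term q g 0 j i n = thetaTerm (q ^ (2 * i + 1)) (q ^ (2 * i + 4 * j + 3)) n +
      thetaTerm (q ^ (2 * i + 1)) (q ^ (2 * i + 4 * j + 3)) (-(n : ℤ) - 1) := by
  have h0 := two_mul_triangle n
  have h1 := two_mul_triangle (n + 1)
  have h2 := two_mul_triangle (-(n : ℤ) - 1)
  have h3 := two_mul_triangle (-(n : ℤ) - 1 + 1)
  have e1 : (2 * i + 1) * triangle n + (2 * i + 4 * j + 3) * triangle (n + 1) =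
      2 * n * ((i + j + 1) * (n + 0) + j) + n := by
    refine Nat.eq_of_mul_eq_mul_left two_pos ?_
    zify
    linear_combination (2 * i + 1 : ℤ) * h0 + (2 * i + 4 * j + 3 : ℤ) * h1
  have e2 : (2 * i + 1) * triangle (-(n : ℤ) - 1) +
      (2 * i + 4 * j + 3) * triangle (-(n : ℤ) - 1 + 1) =
      2 * n * (i + j + 1) * (n + 0 + 1) + (2 * i + 1) * n + 2 * i * (0 + 1) + 2 * 0 + 1 := by
    refine Nat.eq_of_mul_eq_mul_left two_pos ?_
    zify
    linear_combination (2 * i + 1 : ℤ) * h2 + (2 * i + 4 * j + 3 : ℤ) * h3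
  unfold term thetaTerm
  rw [← pow_mul, ← pow_mul, ← pow_add, ← pow_mul, ← pow_mul, ← pow_add, e1, e2,
    Int.negOnePow_sub, Int.negOnePow_one, Int.negOnePow_neg]
  simp [evenProd, shiftProd, Int.negOnePow_def]
  ring

end Reduction

/-! ### Products over residue classes -/

section Products

variable {R : Type*} [CommRing R] {q : R} {M : ℕ}

open Classical in
/-- The product of `1 - q ^ a` over all `a < M` that satisfy `P`. -/
noncomputable def prodOver (q : R) (M : ℕ) (P : ℕ → Prop) : R :=
  ∏ a ∈ (Finset.range M).filter P, (1 - q ^ a)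

lemma prodOver_mul {P Q S : ℕ → Prop} (h : ∀ a, P a → ¬ Q a) (hS : ∀ a, S a ↔ P a ∨ Q a) :
    prodOver q M P * prodOver q M Q = prodOver q M S := by
  classical
  rw [prodOver, prodOver, prodOver, ← Finset.prod_union, ← Finset.filter_or]
  · exact Finset.prod_congr (Finset.filter_congr fun a _ => (hS a).symm) fun _ _ => rfl
  · rw [Finset.disjoint_filter]
    exact fun a _ => h a

/-- Factors with `f m ≥ M` equal `1`, and `m ≤ f m` places every value below `M` among the first `M`
indices. -/
lemma prod_eq_prodOver (hM : ∀ m, M ≤ m → q ^ m = 0) {f : ℕ → ℕ} (hf : ∀ m, m ≤ f m)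
    (hinj : Function.Injective f) {P : ℕ → Prop} (hP : ∀ a, P a ↔ ∃ m, f m = a) :
    ∏ m ∈ Finset.range M, (1 - q ^ f m) = prodOver q M P := by
  classical
  have h : (Finset.range M).filter P = ((Finset.range M).filter fun m => f m < M).image f := by
    ext a
    simp only [Finset.mem_filter, Finset.mem_range, Finset.mem_image, hP]
    constructor
    · rintro ⟨h, m, rfl⟩
      exact ⟨m, ⟨(hf m).trans_lt h, h⟩, rfl⟩
    · rintro ⟨m, ⟨-, h⟩, rfl⟩
      exact ⟨h, m, rfl⟩
  rw [prodOver, Finset.filter_congr_decidable, h, Finset.prod_image hinj.injOn, Finset.prod_filter]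
  refine Finset.prod_congr rfl fun m _ => ?_
  split_ifs with hm
  · rfl
  · rw [hM _ (not_lt.1 hm), sub_zero]

lemma isUnit_prod_one_sub_pow (hM : ∀ m, M ≤ m → q ^ m = 0) {f : ℕ → ℕ} (hf : ∀ m, f m ≠ 0) :
    IsUnit (∏ m ∈ Finset.range M, (1 - q ^ f m)) := by
  rw [IsUnit.prod_iff]
  exact fun m _ => isUnit_one_sub_pow hM (hf m)

/-- After multiplication by `(q;q²)_∞`, the factors `(1 + q^(2m+1))(1 - q^(2m+1))` supply the
missing class `2` modulo `4`, and both sides become the product over all positive `a`. -/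
lemma prodOver_mul_prod_one_add (hM : ∀ m, M ≤ m → q ^ m = 0) :
    prodOver q M (fun a => a ≠ 0 ∧ a % 4 ≠ 2) * ∏ m ∈ Finset.range M, (1 + q ^ (2 * m + 1)) =
      evenProd q M 0 := by
  have h1 : ∏ m ∈ Finset.range M, (1 - q ^ (2 * (2 * m + 1))) = prodOver q M (fun a => a % 4 = 2) :=
    prod_eq_prodOver hM (fun m => by omega) (fun a b h => by omega)
      fun a => ⟨fun h => ⟨a / 4, by omega⟩, fun ⟨m, hm⟩ => by omega⟩
  have h2 : ∏ m ∈ Finset.range M, (1 - q ^ (2 * m + 1)) = prodOver q M (fun a => a % 2 = 1) :=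
    prod_eq_prodOver hM (fun m => by omega) (fun a b h => by omega)
      fun a => ⟨fun h => ⟨a / 2, by omega⟩, fun ⟨m, hm⟩ => by omega⟩
  have h3 : evenProd q M 0 = prodOver q M (fun a => a ≠ 0 ∧ a % 2 = 0) :=
    prod_eq_prodOver hM (f := fun m => 2 * (0 + m + 1)) (fun m => by omega)
      (fun a b h => by simp only at h; omega)
      fun a => ⟨fun h => ⟨a / 2 - 1, by omega⟩, fun ⟨m, hm⟩ => by omega⟩
  have h4 : prodOver q M (fun a => a ≠ 0 ∧ a % 4 ≠ 2) * prodOver q M (fun a => a % 4 = 2) =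
      prodOver q M (fun a => a ≠ 0) := prodOver_mul (fun a h => h.2) fun a => by omega
  have h5 : prodOver q M (fun a => a ≠ 0 ∧ a % 2 = 0) * prodOver q M (fun a => a % 2 = 1) =
      prodOver q M (fun a => a ≠ 0) := prodOver_mul (fun a h => by omega) fun a => by omega
  refine (isUnit_prod_one_sub_pow hM (f := fun m => 2 * m + 1) fun m => by omega).mul_right_cancel ?_
  rw [mul_assoc, ← Finset.prod_mul_distrib, h2, h3, h5, ← h4, ← h1]
  congr 1
  exact Finset.prod_congr rfl fun m _ => by ring

/-- `a` is not congruent to `2` modulo `4` and not congruent to `0` or `± (2 i + 1)` modulo `4 r`,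
where `r = i + j + 1`. -/
def IsAllowed (i j a : ℕ) : Prop :=
  a % 4 ≠ 2 ∧ a % (4 * (i + j + 1)) ≠ 0 ∧ a % (4 * (i + j + 1)) ≠ 2 * i + 1 ∧
    a % (4 * (i + j + 1)) ≠ 2 * i + 4 * j + 3

lemma prodOver_isAllowed_mul (hM : ∀ m, M ≤ m → q ^ m = 0) (i j : ℕ) :
    prodOver q M (IsAllowed i j) *
      ((∏ m ∈ Finset.range M,
          (1 - q ^ (2 * i + 1 + (2 * i + 1 + (2 * i + 4 * j + 3)) * m))) *
        (∏ m ∈ Finset.range M,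
          (1 - q ^ (2 * i + 4 * j + 3 + (2 * i + 1 + (2 * i + 4 * j + 3)) * m))) *
        ∏ m ∈ Finset.range M, (1 - q ^ ((2 * i + 1 + (2 * i + 4 * j + 3)) * (m + 1)))) =
      prodOver q M (fun a => a ≠ 0 ∧ a % 4 ≠ 2) := by
  have hN : 2 * i + 1 + (2 * i + 4 * j + 3) = 4 * (i + j + 1) := by ring
  rw [hN]
  have hpos : 0 < 4 * (i + j + 1) := by omega
  have hmod : ∀ a, a % (4 * (i + j + 1)) % 4 = a % 4 := fun a =>
    Nat.mod_mod_of_dvd a (dvd_mul_right 4 _)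
  have hle : ∀ m, m ≤ 4 * (i + j + 1) * m := fun m => Nat.le_mul_of_pos_left _ hpos
  have hres : ∀ d, d < 4 * (i + j + 1) → ∏ m ∈ Finset.range M,
      (1 - q ^ (d + 4 * (i + j + 1) * m)) = prodOver q M (fun a => a % (4 * (i + j + 1)) = d) := by
    intro d hd
    refine prod_eq_prodOver hM (fun m => (hle m).trans (Nat.le_add_left _ _)) (fun a b h => ?_)
      fun a => ⟨fun h => ⟨a / (4 * (i + j + 1)), ?_⟩, ?_⟩
    · exact Nat.eq_of_mul_eq_mul_left hpos (Nat.add_left_cancel h)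
    · rw [← h]
      exact Nat.mod_add_div _ _
    · rintro ⟨m, rfl⟩
      rw [Nat.add_mul_mod_self_left, Nat.mod_eq_of_lt hd]
  have hzero : ∏ m ∈ Finset.range M, (1 - q ^ (4 * (i + j + 1) * (m + 1))) =
      prodOver q M (fun a => a ≠ 0 ∧ a % (4 * (i + j + 1)) = 0) := by
    refine prod_eq_prodOver hM (fun m => (Nat.le_succ m).trans (hle (m + 1))) (fun a b h => ?_)
      fun a => ⟨?_, ?_⟩
    · exact Nat.succ_injective (Nat.eq_of_mul_eq_mul_left hpos h)
    · rintro ⟨h0, h⟩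
      obtain ⟨m, rfl⟩ := Nat.dvd_of_mod_eq_zero h
      obtain ⟨m, rfl⟩ := Nat.exists_eq_succ_of_ne_zero (Nat.pos_of_mul_pos_left
        (Nat.pos_of_ne_zero h0)).ne'
      exact ⟨m, rfl⟩
    · rintro ⟨m, rfl⟩
      exact ⟨(Nat.mul_pos hpos (Nat.succ_pos m)).ne', Nat.mul_mod_right _ _⟩
  rw [hres _ (by omega), hres _ (by omega), hzero,
    prodOver_mul (S := fun a => a % (4 * (i + j + 1)) = 2 * i + 1 ∨
      a % (4 * (i + j + 1)) = 2 * i + 4 * j + 3) (fun a h => by omega) fun a => Iff.rfl,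
    prodOver_mul (S := fun a => (a % (4 * (i + j + 1)) = 2 * i + 1 ∨
      a % (4 * (i + j + 1)) = 2 * i + 4 * j + 3) ∨ (a ≠ 0 ∧ a % (4 * (i + j + 1)) = 0))
      (fun a h => by omega) fun a => Iff.rfl]
  refine prodOver_mul (fun a h => ?_) fun a => ?_
  · have := h.2
    omega
  · have h0 : a = 0 → a % (4 * (i + j + 1)) = 0 := by
      rintro rfl
      exact Nat.zero_mod _
    -- Reduction modulo `4r` preserves residues modulo `4`, so the classes `0` and `±(2i+1)` never
    -- meet the class `2` modulo `4`.
    have := hmod a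
    unfold IsAllowed
    generalize a % (4 * (i + j + 1)) = e at *
    omega

end Products

/-! ### Equality of the two generating functions -/

/-- Both images are inverse to the product of `1 - q^a` over the allowed `a < M`. -/
lemma map_genFun_eq {R : Type*} [CommRing R] {φ : ℤ⟦X⟧ →+* R} {M : ℕ}
    (hM : ∀ m, M ≤ m → φ X ^ m = 0) (i j : ℕ) :
    φ (genFun (gapMultisets (i + j) 0 i)) = φ (genFun (partsIn (IsAllowed i j))) := by
  classical
  have hunit : ∀ m, ∃ x, (1 + φ X ^ (2 * m + 1)) * x = 1 := fun m =>
    (IsNilpotent.pow_of_pos ⟨M, hM M le_rfl⟩ (Nat.succ_ne_zero _)).isUnit_one_add.exists_right_inv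
  choose g hg using hunit
  have hF := map_genFun_gapMultisets_mul hM hg 0 j i
  have hJ := jacobi_triple_product_nilpotent (b := 2 * i + 1) (c := 2 * i + 4 * j + 3) rfl hM
    (by omega) (by omega)
  rw [series, Finset.sum_congr rfl fun n _ => term_zero_eq_thetaTerm (φ X) g j i n, ← hJ] at hF
  have hA := prodOver_isAllowed_mul hM i j
  have hE := prodOver_mul_prod_one_add hM
  have hinv : (∏ m ∈ Finset.range M, (1 + φ X ^ (2 * m + 1))) * shiftProd g M 0 = 1 := by
    rw [shiftProd, ← Finset.prod_mul_distrib]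
    exact Finset.prod_eq_one fun m _ => by rw [zero_add, hg]
  rw [← hA, ← hF] at hE
  have hEu : IsUnit (evenProd (φ X) M 0) :=
    isUnit_prod_one_sub_pow hM (f := fun m => 2 * (0 + m + 1)) fun m => by omega
  have h1 : prodOver (φ X) M (IsAllowed i j) * φ (genFun (gapMultisets (i + j) 0 i)) = 1 := by
    refine hEu.mul_right_cancel ?_
    rw [one_mul]
    refine Eq.trans ?_ hE
    linear_combination -(prodOver (φ X) M (IsAllowed i j) *
      φ (genFun (gapMultisets (i + j) 0 i)) * evenProd (φ X) M 0) * hinv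
  have h2 : prodOver (φ X) M (IsAllowed i j) * φ (genFun (partsIn (IsAllowed i j))) = 1 := by
    have h := congrArg φ (prod_mul_genFun_partsIn ((Finset.range M).filter (IsAllowed i j))
      fun h => (Finset.mem_filter.1 h).2.2.1 (Nat.zero_mod _))
    rw [map_mul, map_prod, map_one] at h
    simp only [map_sub, map_one, map_pow] at h
    rw [← h]
    congr 1
    -- A part is at most the sum, so in degrees below `M` only parts below `M` occur.
    refine map_eq_of_coeff_eq hM fun n hn => coeff_genFun_congr fun s hs => ?_
    refine forall₂_congr fun a ha => ?_
    change IsAllowed i j a ↔ a ∈ Finset.filter (IsAllowed i j) (Finset.range M)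
    rw [Finset.mem_filter, Finset.mem_range, iff_and_self]
    exact fun _ => ((Multiset.le_sum_of_mem ha).trans hs.le).trans_lt hn
  calc _ = φ (genFun (gapMultisets (i + j) 0 i)) * (prodOver (φ X) M (IsAllowed i j) *
        φ (genFun (partsIn (IsAllowed i j)))) := by rw [h2, mul_one]
    _ = _ := by
      rw [← mul_assoc, mul_comm _ (prodOver _ _ _), h1, one_mul]

/-- The Göllnitz–Gordon–Andrews identities for generating functions. -/
theorem genFun_gapMultisets_eq_genFun_partsIn (i j : ℕ) :
    genFun (gapMultisets (i + j) 0 i) = genFun (partsIn (IsAllowed i j)) := by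
  ext n
  have h : ∀ m, n + 1 ≤ m → Ideal.Quotient.mk (Ideal.span {(X : ℤ⟦X⟧) ^ (n + 1)}) X ^ m = 0 := by
    intro m hm
    rw [← map_pow, Ideal.Quotient.eq_zero_iff_mem, Ideal.mem_span_singleton]
    exact pow_dvd_pow _ hm
  have := map_genFun_eq h i j
  rw [Ideal.Quotient.eq, Ideal.mem_span_singleton, X_pow_dvd_iff] at this
  have := this n (Nat.lt_succ_self n)
  rwa [map_sub, sub_eq_zero] at this

/-! ### From sorted lists to multiplicities -/

section SortedLists

/-- In a non-increasing list, the elements `≥ b` form an initial segment. -/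
lemma le_getElem_iff_lt_countP {l : List ℕ} (hl : l.Pairwise (· ≥ ·)) (b m : ℕ)
    (hm : m < l.length) : b ≤ l[m] ↔ m < l.countP (b ≤ ·) := by
  induction l generalizing m with
  | nil => exact absurd hm (Nat.not_lt_zero m)
  | cons x l ih =>
    rw [List.pairwise_cons] at hl
    by_cases hx : b ≤ x
    · rw [List.countP_cons_of_pos (by simpa using hx)]
      cases m with
      | zero => simpa using hx
      | succ m =>
        rw [List.getElem_cons_succ, ih hl.2 m (by simpa using hm)]
        omega
    · have h0 : ∀ y ∈ x :: l, ¬ b ≤ y := by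
        intro y hy
        rcases List.mem_cons.1 hy with rfl | hy
        · exact hx
        · have := hl.1 y hy
          omega
      have h1 : (x :: l).countP (b ≤ ·) = 0 :=
        List.countP_eq_zero.2 fun y hy => by simpa using h0 y hy
      rw [h1]
      exact iff_of_false (h0 _ (List.getElem_mem _)) (Nat.not_lt_zero m)

variable {n : ℕ} (p : n.Partition)

lemma coe_partList : (partList p : Multiset ℕ) = p.parts := Multiset.sort_eq _ _

lemma mem_partList {a : ℕ} : a ∈ partList p ↔ a ∈ p.parts := Multiset.mem_sort _

lemma pairwise_partList : (partList p).Pairwise (· ≥ ·) := Multiset.pairwise_sort _ _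

lemma le_getElem_partList_iff (b m : ℕ) (hm : m < (partList p).length) :
    b ≤ (partList p)[m] ↔ m < p.parts.countP (b ≤ ·) := by
  rw [le_getElem_iff_lt_countP (pairwise_partList p), ← coe_partList, Multiset.coe_countP]

lemma countP_le_eq (s : Multiset ℕ) (b : ℕ) :
    s.countP (b ≤ ·) = s.countP (b + 1 ≤ ·) + s.count b := by
  induction s using Multiset.induction_on with
  | empty => simp
  | cons a s ih =>
    rw [Multiset.countP_cons, Multiset.countP_cons, Multiset.count_cons, ih]
    split_ifs <;> omega

/-- The part `a` is followed, `d` places later, by a part `≥ b` iff more than `d` parts lie between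
`b` and `a`. -/
lemma exists_getElem_partList_iff (a b d : ℕ) :
    (∃ (m : ℕ) (h : m + d < (partList p).length),
      (partList p)[m] = a ∧ b ≤ (partList p)[m + d]) ↔
      a ∈ p.parts ∧ p.parts.countP (a + 1 ≤ ·) + d < p.parts.countP (b ≤ ·) := by
  constructor
  · rintro ⟨m, h, ha, hb⟩
    have h1 := (le_getElem_partList_iff p (a + 1) m (by omega)).not.1 (by omega)
    have h2 := (le_getElem_partList_iff p b (m + d) h).1 hb
    refine ⟨?_, by omega⟩
    rw [← mem_partList, ← ha]
    exact List.getElem_mem _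
  · rintro ⟨ha, h⟩
    have hlen : p.parts.countP (b ≤ ·) ≤ (partList p).length := by
      rw [← Multiset.coe_card, coe_partList]
      exact Multiset.countP_le_card _ _
    have h1 := countP_le_eq p.parts a
    have h2 := Multiset.count_pos.2 ha
    -- The number of parts exceeding `a` is the index of the first occurrence of `a`.
    refine ⟨p.parts.countP (a + 1 ≤ ·), by omega, ?_, ?_⟩
    · have h3 := (le_getElem_partList_iff p (a + 1) (p.parts.countP (a + 1 ≤ ·)) (by omega)).not.2
        (lt_irrefl _)
      have h4 := (le_getElem_partList_iff p a (p.parts.countP (a + 1 ≤ ·)) (by omega)).2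
        (by omega)
      omega
    · exact (le_getElem_partList_iff p b _ (by omega)).2 h

/-- For `λ_m = 2l+1` and for `λ_m = 2l+2` alike, the required gap says `λ_{m+d} < 2l`. This is why
the gap depends on parity and why the windows start at even integers. -/
lemma hasGaps_iff (d : ℕ) :
    HasGaps d p ↔ ∀ l, p.parts.count (2 * l) + p.parts.count (2 * l + 1) +
      p.parts.count (2 * l + 2) ≤ d := by
  have hc := countP_le_eq p.parts
  have hc' : ∀ l, p.parts.countP (2 * l + 1 ≤ ·) =
      p.parts.countP (2 * l + 2 ≤ ·) + p.parts.count (2 * l + 1) := fun l => hc (2 * l + 1)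
  constructor
  · intro hg l
    have c0 := hc (2 * l)
    have c1 := hc (2 * l + 1)
    have c1' := hc' l
    have c2 := hc (2 * l + 2)
    by_contra hlt
    -- The largest part in an overfull window violates its gap: `d` places after its first
    -- occurrence the list is still at least `2l`.
    by_cases h2 : 2 * l + 2 ∈ p.parts
    · obtain ⟨m, h, ha, hb⟩ := (exists_getElem_partList_iff p (2 * l + 2) (2 * l) d).2
        ⟨h2, by omega⟩
      have := (hg m h).2 (by rw [ha]; exact ⟨l + 1, by omega⟩)
      omega
    · have z2 := Multiset.count_eq_zero.2 h2
      by_cases h1 : 2 * l + 1 ∈ p.parts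
      · obtain ⟨m, h, ha, hb⟩ := (exists_getElem_partList_iff p (2 * l + 1) (2 * l) d).2
          ⟨h1, by omega⟩
        have := (hg m h).1 (by rw [ha]; exact ⟨l, rfl⟩)
        omega
      · have z1 := Multiset.count_eq_zero.2 h1
        by_cases h3 : 2 * l ∈ p.parts
        · obtain ⟨m, h, ha, hb⟩ := (exists_getElem_partList_iff p (2 * l) (2 * l) d).2
            ⟨h3, by omega⟩
          have := (hg m h).2 (by rw [ha]; exact ⟨l, by omega⟩)
          omega
        · have z0 := Multiset.count_eq_zero.2 h3
          omega
  · intro hl m h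
    have hpos : 0 < (partList p)[m] := p.parts_pos ((mem_partList p).1 (List.getElem_mem _))
    constructor
    · rintro ⟨l, ha⟩
      by_contra hlt
      have := ((exists_getElem_partList_iff p (2 * l + 1) (2 * l) d).1
        ⟨m, h, ha, by omega⟩).2
      have := hl l
      have := hc (2 * l)
      have := hc (2 * l + 1)
      omega
    · rintro ⟨l, ha⟩
      obtain ⟨l, rfl⟩ := Nat.exists_eq_succ_of_ne_zero (show l ≠ 0 by omega)
      by_contra hlt
      have := ((exists_getElem_partList_iff p (2 * l + 2) (2 * l) d).1
        ⟨m, h, by omega, by omega⟩).2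
      have := hl l
      have := hc (2 * l)
      have := hc' l
      have c2 := hc (2 * l + 2)
      omega

lemma isDPartition_iff (i j : ℕ) :
    IsDPartition (i + j + 1) (i + 1) p ↔ p.parts ∈ gapMultisets (i + j) 0 i := by
  rw [mem_gapMultisets]
  constructor
  · intro h
    refine ⟨fun a ha => p.parts_pos ha, fun l => ?_, (hasGaps_iff p _).1 h.gaps, h.ones_twos⟩
    by_cases hl : 2 * l + 1 ∈ p.parts
    · exact (h.odd_not_repeated _ hl ⟨l, rfl⟩).le
    · rw [Multiset.count_eq_zero.2 hl]
      exact zero_le_one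
  · intro h
    refine ⟨?_, (hasGaps_iff p _).2 h.triple_le, h.bottom_le⟩
    rintro a ha ⟨l, rfl⟩
    exact le_antisymm (h.odd_le l) (Multiset.count_pos.2 ha)

end SortedLists

/-! ### Congruence conditions and equality of the counts -/

lemma isAllowed_iff (i j a : ℕ) :
    (¬ (a : ℤ) ≡ 2 [ZMOD 4] ∧
      ¬ (a : ℤ) ≡ 0 [ZMOD 4 * ((i + j + 1 : ℕ) : ℤ)] ∧
      ¬ (a : ℤ) ≡ 2 * ((i + 1 : ℕ) : ℤ) - 1 [ZMOD 4 * ((i + j + 1 : ℕ) : ℤ)] ∧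
      ¬ (a : ℤ) ≡ -(2 * ((i + 1 : ℕ) : ℤ) - 1) [ZMOD 4 * ((i + j + 1 : ℕ) : ℤ)]) ↔
      IsAllowed i j a := by
  have key : ∀ (b : ℕ), b < 4 * (i + j + 1) →
      ((a : ℤ) ≡ b [ZMOD 4 * ((i + j + 1 : ℕ) : ℤ)] ↔ a % (4 * (i + j + 1)) = b) := by
    intro b hb
    rw [show (4 * ((i + j + 1 : ℕ) : ℤ)) = ((4 * (i + j + 1) : ℕ) : ℤ) by push_cast; ring,
      Int.natCast_modEq_iff, Nat.ModEq, Nat.mod_eq_of_lt hb]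
  have h3 : (a : ℤ) ≡ -(2 * ((i + 1 : ℕ) : ℤ) - 1) [ZMOD 4 * ((i + j + 1 : ℕ) : ℤ)] ↔
      (a : ℤ) ≡ ((2 * i + 4 * j + 3 : ℕ) : ℤ) [ZMOD 4 * ((i + j + 1 : ℕ) : ℤ)] := by
    have : -(2 * ((i + 1 : ℕ) : ℤ) - 1) ≡ ((2 * i + 4 * j + 3 : ℕ) : ℤ)
        [ZMOD 4 * ((i + j + 1 : ℕ) : ℤ)] := by
      refine (Int.modEq_iff_dvd).2 ⟨1, ?_⟩
      push_cast
      ring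
    exact ⟨fun h => h.trans this, fun h => h.trans this.symm⟩
  have h1 : (2 * ((i + 1 : ℕ) : ℤ) - 1) = ((2 * i + 1 : ℕ) : ℤ) := by
    push_cast
    ring
  have h4 : (a : ℤ) ≡ 2 [ZMOD 4] ↔ a % 4 = 2 := by
    unfold Int.ModEq
    omega
  have h0 := key 0 (by omega)
  rw [Nat.cast_zero] at h0
  rw [h3, h1, h4, h0, key _ (by omega), key _ (by omega)]
  rfl

theorem numC_eq_numD (i j n : ℕ) : numC (i + j + 1) (i + 1) n = numD (i + j + 1) (i + 1) n := by
  have hC : numC (i + j + 1) (i + 1) n =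
      Nat.card {p : n.Partition // p.parts ∈ partsIn (IsAllowed i j)} :=
    Nat.card_congr (Equiv.subtypeEquivRight fun p => forall₂_congr fun a _ => isAllowed_iff i j a)
  have hD : numD (i + j + 1) (i + 1) n =
      Nat.card {p : n.Partition // p.parts ∈ gapMultisets (i + j) 0 i} :=
    Nat.card_congr (Equiv.subtypeEquivRight fun p => isDPartition_iff p i j)
  have h0 : ∀ s ∈ partsIn (IsAllowed i j), 0 ∉ s := fun s hs h => (hs 0 h).2.1 (Nat.zero_mod _)
  rw [hC, hD, ← Nat.cast_inj (R := ℤ), card_partition h0,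
    card_partition zero_notMem_of_mem_gapMultisets, genFun_gapMultisets_eq_genFun_partsIn]

/-! ### The classical case `r = 2` -/

section Classical

variable {n : ℕ} (p : n.Partition)

lemma odd_imp_and_even_imp_iff (x y : ℕ) :
    (Odd x → y + 2 ≤ x) ∧ (Even x → y + 3 ≤ x) ↔ y + 2 ≤ x ∧ (Even x → y + 3 ≤ x) := by
  refine ⟨fun h => ⟨?_, h.2⟩, fun h => ⟨fun _ => h.1, h.2⟩⟩
  rcases Nat.even_or_odd x with he | ho
  · exact (Nat.le_succ _).trans (h.2 he)
  · exact h.1 ho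

/-- For `r = 2` each window holds at most one part, so no odd part can repeat. -/
lemma isDPartition_two_iff (i : ℕ) :
    IsDPartition 2 i p ↔ p.parts.count 1 + p.parts.count 2 ≤ i - 1 ∧ HasGaps 1 p := by
  refine ⟨fun h => ⟨h.ones_twos, h.gaps⟩, fun h => ⟨?_, h.2, h.1⟩⟩
  rintro a ha ⟨l, rfl⟩
  have := (hasGaps_iff p 1).1 h.2 l
  have := Multiset.count_pos.2 ha
  omega

lemma isDPartition_two_two_iff : IsDPartition 2 2 p ↔ HasGaps 1 p := by
  rw [isDPartition_two_iff, and_iff_right_iff_imp]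
  intro h
  have := (hasGaps_iff p 1).1 h 0
  simp only [mul_zero, zero_add] at this
  omega

lemma isDPartition_two_one_iff :
    IsDPartition 2 1 p ↔ (∀ a ∈ p.parts, 3 ≤ a) ∧ HasGaps 1 p := by
  rw [isDPartition_two_iff]
  refine and_congr_left fun _ => ?_
  rw [Nat.sub_self, Nat.le_zero, Nat.add_eq_zero_iff, Multiset.count_eq_zero,
    Multiset.count_eq_zero]
  constructor
  · rintro ⟨h1, h2⟩ a ha
    have := p.parts_pos ha
    have : a ≠ 1 := fun h => h1 (h ▸ ha)
    have : a ≠ 2 := fun h => h2 (h ▸ ha)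
    omega
  · exact fun h => ⟨fun ha => absurd (h 1 ha) (by norm_num),
      fun ha => absurd (h 2 ha) (by norm_num)⟩

lemma isCPartition_two_two_iff :
    IsCPartition 2 2 p ↔ ∀ a ∈ p.parts, a % 8 = 1 ∨ a % 8 = 4 ∨ a % 8 = 7 := by
  refine forall₂_congr fun a _ => (isAllowed_iff 1 0 a).trans ?_
  unfold IsAllowed
  omega

lemma isCPartition_two_one_iff :
    IsCPartition 2 1 p ↔ ∀ a ∈ p.parts, a % 8 = 3 ∨ a % 8 = 4 ∨ a % 8 = 5 := by
  refine forall₂_congr fun a _ => (isAllowed_iff 0 1 a).trans ?_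
  unfold IsAllowed
  omega

end Classical

end GollnitzGordon

open GollnitzGordon in
theorem theorem1 :
    -- the Göllnitz–Gordon–Andrews identities
    (∀ r i : ℕ, 1 ≤ i → i ≤ r → ∀ n : ℕ, numC r i n = numD r i n) ∧
    -- the first Göllnitz–Gordon identity (`r = i = 2`)
    (∀ n : ℕ,
      Nat.card {p : n.Partition // ∀ a ∈ p.parts, a % 8 = 1 ∨ a % 8 = 4 ∨ a % 8 = 7} =
        Nat.card {p : n.Partition // ∀ (m : ℕ) (h : m + 1 < (partList p).length),
          (partList p)[m + 1] + 2 ≤ (partList p)[m] ∧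
          (Even ((partList p)[m]) → (partList p)[m + 1] + 3 ≤ (partList p)[m])}) ∧
    -- the second Göllnitz–Gordon identity (`r = 2`, `i = 1`)
    (∀ n : ℕ,
      Nat.card {p : n.Partition // ∀ a ∈ p.parts, a % 8 = 3 ∨ a % 8 = 4 ∨ a % 8 = 5} =
        Nat.card {p : n.Partition // (∀ a ∈ p.parts, 3 ≤ a) ∧
          ∀ (m : ℕ) (h : m + 1 < (partList p).length),
            (partList p)[m + 1] + 2 ≤ (partList p)[m] ∧
            (Even ((partList p)[m]) → (partList p)[m + 1] + 3 ≤ (partList p)[m])}) := by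
  refine ⟨fun r i hi hir n => ?_, fun n => ?_, fun n => ?_⟩
  · obtain ⟨i, rfl⟩ := Nat.exists_eq_add_of_le' hi
    obtain ⟨j, rfl⟩ := Nat.exists_eq_add_of_le hir
    rw [add_right_comm i 1 j]
    exact numC_eq_numD i j n
  · refine Eq.trans ?_ ((numC_eq_numD 1 0 n).trans ?_)
    · exact Nat.card_congr (Equiv.subtypeEquivRight fun p => (isCPartition_two_two_iff p).symm)
    · exact Nat.card_congr (Equiv.subtypeEquivRight fun p =>
        (isDPartition_two_two_iff p).trans
          (forall₂_congr fun _ _ => odd_imp_and_even_imp_iff _ _))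
  · refine Eq.trans ?_ ((numC_eq_numD 0 1 n).trans ?_)
    · exact Nat.card_congr (Equiv.subtypeEquivRight fun p => (isCPartition_two_one_iff p).symm)
    · exact Nat.card_congr (Equiv.subtypeEquivRight fun p =>
        (isDPartition_two_one_iff p).trans
          (and_congr_right' (forall₂_congr fun _ _ => odd_imp_and_even_imp_iff _ _)))
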